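/- Let $\mathcal K$ be a locally presentable abelian category. For a class $\mathcal A$ of objects of $\mathcal K$ put $$\mathcal A^\perp=\{B : \operatorname{Ext}^1_{\mathcal K}(A,B)=0 \text{ for all } A\in\mathcal A\},\qquad {}^\perp\mathcal A=\{B : \operatorname{Ext}^1_{\mathcal K}(B,A)=0 \text{ for all } A\in\mathcal A\}.$$ Let $(\mathcal F,\mathcal C)$ be a cotorsion theory in $\mathcal K$, that is, a pair of classes of objects with $\mathcal C=\mathcal F^\perp$ and $\mathcal F={}^\perp\mathcal C$, and suppose that it is generated by a set, that is, $\mathcal C=\mathcal S^\perp$ for some set $\mathcal S$ of objects of $\mathcal K$. Suppose that every object of $\mathcal K$ is a quotient of an object of $\mathcal F$ and a subobject of an object of $\mathcal C$. Let $\mathcal F\text{-Mono}$ be the class of all monomorphisms whose cokernel belongs to $\mathcal F$, and $\mathcal C\text{-Epi}$ the class of all epimorphisms whose kernel belongs to $\mathcal C$. Then: (1) $(\mathcal F\text{-Mono},\,\mathcal C\text{-Epi})$ is a weak factorization system: $\mathcal C\text{-Epi}$ is the class of all morphisms having the right lifting property with respect to every morphism of $\mathcal F\text{-Mono}$, $\mathcal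 F\text{-Mono}$ is the class of all morphisms having the left lifting property with respect to every morphism of $\mathcal C\text{-Epi}$, and every morphism $f$ of $\mathcal K$ factors as $f=r\,l$ with $l\in\mathcal F\text{-Mono}$ and $r\in\mathcal C\text{-Epi}$. (2) $(\mathcal F,\mathcal C)$ is complete: every object $K$ of $\mathcal K$ has a special $\mathcal F$-precover, that is, a morphism $F\to K$ in $\mathcal C\text{-Epi}$ with $F\in\mathcal F$, and a special $\mathcal C$-preenvelope, that is, a morphism $K\to C$ in $\mathcal F\text{-Mono}$ with $C\in\mathcal C$. -/

import Mathlib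

open CategoryTheory CategoryTheory.Limits

universe w v u

namespace Cotorsion

section

variable {K : Type u} [Category.{v} K] [Abelian K]

/-- `Ext¹_K(A, B) = 0`, for the Ext groups of Mathlib (morphisms in the derived category, which
in an arbitrary abelian category agree with Yoneda's Ext groups). They are formed in the universe
`max u v`, where they exist for every abelian category, so that no enough-projectives,
enough-injectives or size assumption is involved. -/
def ExtOneVanishes (A B : K) : Prop :=
  letI : HasExt.{max u v} K := HasExt.standard K
  Subsingleton (Abelian.Ext.{max u v} A B 1)

/-- `A^⊥`: the class of all objects `B` with `Ext¹(A, B) = 0` for all `A` in the class. -/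
def rightPerp (𝒜 : ObjectProperty K) : ObjectProperty K :=
  fun B ↦ ∀ A : K, 𝒜 A → ExtOneVanishes A B

/-- `^⊥B`: the class of all objects `A` with `Ext¹(A, B) = 0` for all `B` in the class. -/
def leftPerp (ℬ : ObjectProperty K) : ObjectProperty K :=
  fun A ↦ ∀ B : K, ℬ B → ExtOneVanishes A B

/-- `𝒜-Mono`: the class of all monomorphisms whose cokernel belongs to `𝒜`. (The classes used
below are orthogonal classes, hence closed under isomorphisms, so that the choice of the cokernel
is immaterial.) -/
def relMono (𝒜 : ObjectProperty K) : MorphismProperty K :=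
  fun _ _ f ↦ Mono f ∧ 𝒜 (cokernel f)

/-- `ℬ-Epi`: the class of all epimorphisms whose kernel belongs to `ℬ`. -/
def relEpi (ℬ : ObjectProperty K) : MorphismProperty K :=
  fun _ _ f ↦ Epi f ∧ ℬ (kernel f)

/-- `(ℱ, 𝒞)` is a cotorsion theory: `𝒞 = ℱ^⊥` and `ℱ = ^⊥𝒞`. -/
structure IsCotorsionTheory (ℱ 𝒞 : ObjectProperty K) : Prop where
  right_eq : 𝒞 = rightPerp ℱ
  left_eq : ℱ = leftPerp 𝒞

/-- A special `ℱ`-precover of `X`: a `𝒞`-epimorphism `F ⟶ X` with `F` in `ℱ`. -/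
def IsSpecialPrecover (ℱ 𝒞 : ObjectProperty K) {F X : K} (p : F ⟶ X) : Prop :=
  ℱ F ∧ relEpi 𝒞 p

/-- A special `𝒞`-preenvelope of `X`: an `ℱ`-monomorphism `X ⟶ C` with `C` in `𝒞`. -/
def IsSpecialPreenvelope (ℱ 𝒞 : ObjectProperty K) {X C : K} (i : X ⟶ C) : Prop :=
  𝒞 C ∧ relMono ℱ i

/-- A complete cotorsion theory: every object has a special `ℱ`-precover and a special
`𝒞`-preenvelope. -/
structure IsCompleteCotorsionTheory (ℱ 𝒞 : ObjectProperty K) : Prop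
    extends IsCotorsionTheory ℱ 𝒞 where
  exists_specialPrecover (X : K) : ∃ (F : K) (p : F ⟶ X), IsSpecialPrecover ℱ 𝒞 p
  exists_specialPreenvelope (X : K) : ∃ (C : K) (i : X ⟶ C), IsSpecialPreenvelope ℱ 𝒞 i

/-- The cotorsion theory with right class `𝒞` is generated by a set: `𝒞 = 𝒮^⊥` for a (`w`-small)
set `𝒮` of objects. -/
def IsGeneratedBySet (𝒞 : ObjectProperty K) : Prop :=
  ∃ 𝒮 : ObjectProperty K, ObjectProperty.Small.{w} 𝒮 ∧ 𝒞 = rightPerp 𝒮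

end

end Cotorsion

namespace Cotorsion
section
variable {K : Type u} [Category.{v} K] [Abelian K]

/-! The small object argument produces the factorizations, once a small set `I` of `ℱ`-monomorphisms
with `I.rlp = relEpi 𝒞` is known. Take `κ` with `K` locally `κ`-presentable and all of `𝒮`
`κ`-presentable, and a small generator `P`. Then `I` consists of the kernels of epimorphisms from
`P` to `𝒮`, which control kernels (`rightPerp_kernel_of_rlp`), and of maps `0 ⟶ F` with `F` in `ℱ`
covering an object of `P`, which force epimorphisms. The kernels suffice because an epimorphism onto
a `κ`-presentable object stays epi on some stage of a `κ`-filtered colimit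
(`exists_epi_of_isColimit`). That `ℱ`-Mono is all of the left class comes from translating lifting
into splitting of extensions. -/

open DerivedCategory HomologicalComplex in
lemma exists_epi_single_map_comp_eq_zero [HasDerivedCategory.{w} K] {A : K}
    {L : CochainComplex K ℤ} {i : ℤ}
    (φ : Q.obj ((single K (ComplexShape.up ℤ) i).obj A) ⟶ Q.obj L)
    (n : ℤ) (hn : n < i) [L.IsStrictlyLE n] :
    ∃ (B : K) (p : B ⟶ A),
      Epi p ∧ Q.map ((single K (ComplexShape.up ℤ) i).map p) ≫ φ = 0 := by
  have : CochainComplex.IsStrictlyLE ((single K (ComplexShape.up ℤ) i).obj A) i :=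
    inferInstanceAs (CochainComplex.IsStrictlyLE
      ((CochainComplex.singleFunctor K i).obj A) i)
  obtain ⟨X, _, s, hs, g, rfl⟩ := right_fac_of_isStrictlyLE φ i
  have hs' := hs
  rw [isIso_Q_map_iff_quasiIso] at hs'
  -- Degree `i` is the top degree of `X`, so all of `X.X i` is cycles and surjects onto the homology
  -- `A`.
  have hd : X.d i (i + 1) = 0 := (X.isZero_of_isStrictlyLE i (i + 1) (by simp)).eq_of_tgt _ _
  let e := X.iCyclesIso i (i + 1) (by simp) hd
  let p : X.X i ⟶ A := e.inv ≫ X.homologyπ i ≫ homologyMap s i ≫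
    (singleObjHomologySelfIso (ComplexShape.up ℤ) i A).hom
  have hp : Epi p := by
    have : Epi (homologyMap s i ≫ (singleObjHomologySelfIso (ComplexShape.up ℤ) i A).hom) :=
      epi_comp _ _
    have : Epi (X.homologyπ i ≫ homologyMap s i ≫
      (singleObjHomologySelfIso (ComplexShape.up ℤ) i A).hom) := epi_comp _ _
    exact epi_comp _ _
  have hsp : s.f i = p ≫ (singleObjXSelf (ComplexShape.up ℤ) i A).inv := by
    rw [← cancel_epi e.hom]
    simp only [p, e, Category.assoc, iCyclesIso_hom, iCyclesIso_hom_inv_id_assoc,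
      homologyπ_naturality_assoc, homologyπ_singleObjHomologySelfIso_hom_assoc,
      ← singleObjCyclesSelfIso_inv_iCycles, Iso.hom_inv_id_assoc, cyclesMap_i]
  let j : (single K (ComplexShape.up ℤ) i).obj (X.X i) ⟶ X :=
    mkHomFromSingle (𝟙 _) (by
      rintro _ rfl
      rw [Category.id_comp, hd])
  have hj : j ≫ s = (single K (ComplexShape.up ℤ) i).map p := by
    apply from_single_hom_ext
    rw [comp_f, mkHomFromSingle_f, hsp, single_map_f_self]
    simp
  have hg : j ≫ g = 0 := by
    apply from_single_hom_ext
    apply (L.isZero_of_isStrictlyLE n i hn).eq_of_tgt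
  refine ⟨_, p, hp, ?_⟩
  rw [← hj, Q.map_comp, Category.assoc, IsIso.hom_inv_id_assoc, ← Q.map_comp, hg, Q.map_zero]

-- After a shift, `x` is a map from `A` in degree `0` to `C` in degree `-(n + 1)`, which is strictly
-- lower.
open DerivedCategory in
lemma exists_epi_mk₀_comp_eq_zero [HasExt.{w} K] {A C : K} {n : ℕ}
    (x : Abelian.Ext.{w} A C (n + 1)) :
    ∃ (B : K) (p : B ⟶ A), Epi p ∧ (Abelian.Ext.mk₀ p).comp x (zero_add _) = 0 := by
  let := HasDerivedCategory.standard K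
  obtain ⟨B, p, hp, h⟩ := exists_epi_single_map_comp_eq_zero
    (L := (CochainComplex.singleFunctor K (-(n + 1))).obj C)
    (x.hom ≫ ((singleFunctors K).shiftIso (n + 1) (-(n + 1)) 0 (by lia)).hom.app _)
    (-(n + 1)) (by lia)
  refine ⟨B, p, hp, ?_⟩
  apply Abelian.Ext.homEquiv.injective
  simp only [← cancel_mono (((singleFunctors K).shiftIso (n + 1) (-(n + 1)) 0
    (by lia)).hom.app _)]
  change ((Abelian.Ext.mk₀ p).comp x (zero_add _)).hom ≫ _ = (0 : Abelian.Ext B C (n + 1)).hom ≫ _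
  rw [← Abelian.Ext.singleFunctor_map_comp_hom, Abelian.Ext.zero_hom, zero_comp, Category.assoc]
  exact h

/-- `Ext¹(A, C)` vanishes as soon as every extension of `A` by `C` splits. -/
lemma extOneVanishes_of_section {A C : K}
    (h : ∀ {E : K} (i : C ⟶ E) (p : E ⟶ A) (w : i ≫ p = 0),
      (ShortComplex.mk i p w).ShortExact → ∃ s : A ⟶ E, s ≫ p = 𝟙 A) :
    ExtOneVanishes A C := by
  let := HasExt.standard K
  refine subsingleton_of_forall_eq 0 fun x ↦ ?_
  obtain ⟨B, p, hp, hx⟩ := exists_epi_mk₀_comp_eq_zero (n := 0) x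
  have hS : (ShortComplex.mk (kernel.ι p) p (kernel.condition p)).ShortExact :=
    { exact := ShortComplex.exact_of_f_is_kernel _ (kernelIsKernel p) }
  obtain ⟨y, rfl⟩ := Abelian.Ext.contravariant_sequence_exact₃ hS C x hx (n₀ := 0) rfl
  obtain ⟨f, rfl⟩ := Abelian.Ext.addEquiv₀.symm.surjective y
  -- Pushing out along `f` gives an extension of `A` by `C` with class `x`; a section of `q` kills
  -- that class.
  let q : pushout (kernel.ι p) f ⟶ A := pushout.desc p 0 (by simp)
  have hq : pushout.inl _ _ ≫ q = p := pushout.inl_desc _ _ _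
  have hw : pushout.inr (kernel.ι p) f ≫ q = 0 := pushout.inr_desc _ _ _
  have hw' {Z : K} (k : A ⟶ Z) : pushout.inr (kernel.ι p) f ≫ q ≫ k = 0 := by
    rw [← Category.assoc, hw, zero_comp]
  have hepi : Epi q := epi_of_epi_fac hq
  have hcoker : IsColimit (CokernelCofork.ofπ q hw) :=
    CokernelCofork.IsColimit.ofπ' q hw fun {Z} k hk ↦
      ⟨hS.exact.desc (pushout.inl _ _ ≫ k) (by
          dsimp; rw [pushout.condition_assoc, hk, comp_zero]), by
        apply pushout.hom_ext
        · rw [reassoc_of% hq]; exact hS.exact.g_desc _ _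
        · exact (hw' _).trans hk.symm⟩
  have hS' : (ShortComplex.mk _ q hw).ShortExact :=
    { exact := ShortComplex.exact_of_g_is_cokernel _ hcoker }
  obtain ⟨s, hs⟩ := h _ q hw hS'
  let φ : ShortComplex.mk (kernel.ι p) p (kernel.condition p) ⟶ ShortComplex.mk _ q hw :=
    { τ₁ := f
      τ₂ := pushout.inl _ _
      τ₃ := 𝟙 A
      comm₁₂ := pushout.condition.symm
      comm₂₃ := by dsimp; rw [hq, Category.comp_id] }
  have h₁ := ShortComplex.ShortExact.extClass_naturality hS hS' φ
  have h₂ : (Abelian.Ext.mk₀ (𝟙 A)).comp hS'.extClass (zero_add 1) = 0 := by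
    rw [← hs, ← Abelian.Ext.mk₀_comp_mk₀_assoc, hS'.comp_extClass, Abelian.Ext.comp_zero]
  exact h₁.trans h₂

lemma ExtOneVanishes.of_iso_left {A A' C : K} (e : A ≅ A') (h : ExtOneVanishes A C) :
    ExtOneVanishes A' C := by
  let := HasExt.standard K
  have : Subsingleton (Abelian.Ext A C 1) := h
  refine subsingleton_of_forall_eq 0 fun x ↦ ?_
  rw [← x.mk₀_id_comp, ← e.inv_hom_id, ← Abelian.Ext.mk₀_comp_mk₀_assoc,
    Subsingleton.elim ((Abelian.Ext.mk₀ e.hom).comp x (zero_add _)) 0, Abelian.Ext.comp_zero]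

lemma ExtOneVanishes.of_iso_right {A C C' : K} (e : C ≅ C') (h : ExtOneVanishes A C) :
    ExtOneVanishes A C' := by
  let := HasExt.standard K
  have : Subsingleton (Abelian.Ext A C 1) := h
  refine subsingleton_of_forall_eq 0 fun x ↦ ?_
  rw [← x.comp_mk₀_id, ← e.inv_hom_id, ← Abelian.Ext.mk₀_comp_mk₀,
    ← Abelian.Ext.comp_assoc_of_third_deg_zero,
    Subsingleton.elim (x.comp (Abelian.Ext.mk₀ e.inv) (add_zero _)) 0, Abelian.Ext.zero_comp]

/-- A monomorphism has the left lifting property with respect to an epimorphism if there are no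
nontrivial extensions of the cokernel of the former by the kernel of the latter. -/
lemma ExtOneVanishes.hasLiftingProperty {A B X Y : K} (i : A ⟶ B) (p : X ⟶ Y) [Mono i] [Epi p]
    (h : ExtOneVanishes (cokernel i) (kernel p)) : HasLiftingProperty i p := by
  let := HasExt.standard K
  have : Subsingleton (Abelian.Ext (cokernel i) (kernel p) 1) := h
  have hi : (ShortComplex.mk i (cokernel.π i) (cokernel.condition i)).ShortExact :=
    { exact := ShortComplex.exact_of_g_is_cokernel _ (cokernelIsCokernel i) }
  have hp : (ShortComplex.mk (kernel.ι p) p (kernel.condition p)).ShortExact :=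
    { exact := ShortComplex.exact_of_f_is_kernel _ (kernelIsKernel p) }
  refine ⟨fun {u v} sq ↦ ?_⟩
  -- The obstruction to lifting `v` through `p` dies on `A`, where `u` is a lift, so it comes from
  -- `Ext¹(coker i, ker p) = 0`.
  have hv : (Abelian.Ext.mk₀ v).comp hp.extClass (zero_add 1) = 0 := by
    obtain ⟨y, hy⟩ := Abelian.Ext.contravariant_sequence_exact₂ hi (kernel p)
      ((Abelian.Ext.mk₀ v).comp hp.extClass (zero_add 1)) (by
        dsimp
        rw [Abelian.Ext.mk₀_comp_mk₀_assoc, ← sq.w, ← Abelian.Ext.mk₀_comp_mk₀_assoc,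
          hp.comp_extClass, Abelian.Ext.comp_zero])
    rw [← hy, Subsingleton.elim y 0, Abelian.Ext.comp_zero]
  obtain ⟨y, hy⟩ := Abelian.Ext.covariant_sequence_exact₃ B hp _ _ hv
  obtain ⟨b, rfl⟩ := Abelian.Ext.addEquiv₀.symm.surjective y
  have hb : b ≫ p = v := (Abelian.Ext.mk₀_bijective _ _).1 (by simpa using hy)
  -- The lift `b` need not restrict to `u`; the defect lands in `ker p` and extends to `B` by the
  -- same vanishing.
  let n : A ⟶ kernel p := kernel.lift p (u - i ≫ b) (by simp [hb, sq.w])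
  obtain ⟨z, hz⟩ := Abelian.Ext.contravariant_sequence_exact₁ hi _ (Abelian.Ext.mk₀ n) rfl
    (Subsingleton.elim _ _)
  obtain ⟨m, rfl⟩ := Abelian.Ext.addEquiv₀.symm.surjective z
  have hm : i ≫ m = n := (Abelian.Ext.mk₀_bijective _ _).1 (by simpa using hz)
  exact ⟨⟨{
    l := b + m ≫ kernel.ι p
    fac_left := by simp [reassoc_of% hm, n]
    fac_right := by simp [hb] }⟩⟩

/-! ### Cotorsion theories and lifting properties -/

variable {ℱ 𝒞 : ObjectProperty K}

lemma rightPerp_of_iso {𝒜 : ObjectProperty K} {C C' : K} (e : C ≅ C') (h : rightPerp 𝒜 C) :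
    rightPerp 𝒜 C' :=
  fun A hA ↦ (h A hA).of_iso_right e

lemma leftPerp_of_iso {ℬ : ObjectProperty K} {A A' : K} (e : A ≅ A') (h : leftPerp ℬ A) :
    leftPerp ℬ A' :=
  fun B hB ↦ (h B hB).of_iso_left e

lemma IsCotorsionTheory.left_of_iso (h : IsCotorsionTheory ℱ 𝒞) {A A' : K} (e : A ≅ A')
    (hA : ℱ A) : ℱ A' := by
  rw [h.left_eq] at hA ⊢
  exact leftPerp_of_iso e hA

lemma IsCotorsionTheory.right_of_iso (h : IsCotorsionTheory ℱ 𝒞) {C C' : K} (e : C ≅ C')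
    (hC : 𝒞 C) : 𝒞 C' := by
  rw [h.right_eq] at hC ⊢
  exact rightPerp_of_iso e hC

lemma IsCotorsionTheory.extOneVanishes (h : IsCotorsionTheory ℱ 𝒞) {A C : K} (hA : ℱ A)
    (hC : 𝒞 C) : ExtOneVanishes A C := by
  rw [h.left_eq] at hA
  exact hA C hC

lemma IsCotorsionTheory.relMono_le_llp (h : IsCotorsionTheory ℱ 𝒞) :
    relMono ℱ ≤ (relEpi 𝒞).llp := by
  rintro A B i ⟨_, hi⟩ X Y p ⟨_, hp⟩
  exact (h.extOneVanishes hi hp).hasLiftingProperty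

lemma IsCotorsionTheory.relEpi_le_rlp (h : IsCotorsionTheory ℱ 𝒞) :
    relEpi 𝒞 ≤ (relMono ℱ).rlp :=
  fun _ _ _ hp _ _ _ hi ↦ h.relMono_le_llp _ hi _ hp

open ZeroObject in
lemma relEpi_zero_iff (h : IsCotorsionTheory ℱ 𝒞) {C : K} :
    relEpi 𝒞 (0 : C ⟶ 0) ↔ 𝒞 C :=
  ⟨fun hC ↦ h.right_of_iso kernelZeroIsoSource hC.2,
    fun hC ↦ ⟨inferInstance, h.right_of_iso kernelZeroIsoSource.symm hC⟩⟩

-- Lifting an embedding `A ⟶ C` against `C ⟶ 0` shows that `f` is mono. Lifting `cokernel.π f`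
-- against the epimorphism of an extension, with zero on `A`, gives a map that descends to a
-- section.
open ZeroObject in
lemma IsCotorsionTheory.llp_le_relMono (h : IsCotorsionTheory ℱ 𝒞)
    (hsub : ∀ X : K, ∃ (C : K) (i : X ⟶ C), 𝒞 C ∧ Mono i) :
    (relEpi 𝒞).llp ≤ relMono ℱ := by
  intro A B f hf
  have : Mono f := by
    obtain ⟨C, i, hC, _⟩ := hsub A
    have := hf _ ((relEpi_zero_iff h).2 hC)
    have sq : CommSq i f (0 : C ⟶ 0) 0 := ⟨by simp⟩
    exact mono_of_mono_fac sq.fac_left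
  refine ⟨this, ?_⟩
  rw [h.left_eq]
  refine fun C hC ↦ extOneVanishes_of_section fun {E} i p w hS ↦ ?_
  have := hS.mono_f
  have := hS.epi_g
  have hp : relEpi 𝒞 p := ⟨hS.epi_g,
    h.right_of_iso (IsLimit.conePointUniqueUpToIso hS.fIsKernel (limit.isLimit _)) hC⟩
  have := hf _ hp
  have sq : CommSq (0 : A ⟶ E) f p (cokernel.π f) := ⟨by simp⟩
  exact ⟨cokernel.desc f sq.lift sq.fac_left, by ext; simp⟩

/-- A small family of presentable objects is uniformly presentable. -/
lemma exists_regular_forall_isCardinalPresentable {K : Type u} [Category.{v} K]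
    {ι : Type*} [Small.{w} ι] (X : ι → K) [∀ i, IsPresentable.{w} (X i)] (κ₀ : Cardinal.{w}) :
    ∃ (κ : Cardinal.{w}) (_ : Fact κ.IsRegular),
      κ₀ ≤ κ ∧ ∀ i, IsCardinalPresentable (X i) κ := by
  choose κ hκ hX using fun i ↦ Functor.IsAccessible.exists_cardinal.{w}
    (F := coyoneda.obj (Opposite.op (X i)))
  obtain ⟨κ', hκ', h⟩ := HasCardinalLT.exists_regular_cardinal_forall.{w}
    (Sum.elim (fun _ : Unit ↦ κ₀.ord.ToType) fun i ↦ (κ i).ord.ToType)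
  have : Fact κ'.IsRegular := ⟨hκ'⟩
  refine ⟨κ', this, ?_, fun i ↦ ?_⟩
  · exact le_of_lt (by simpa [hasCardinalLT_iff_cardinal_mk_lt] using h (.inl ⟨⟩))
  · have := hκ i
    have := hX i
    exact isCardinalPresentable_of_le (X i) (κ := κ i)
      (le_of_lt (by simpa [hasCardinalLT_iff_cardinal_mk_lt] using h (.inr i)))

/-- For `κ` making every source in `I` `κ`-presentable, maps out of these sources commute with
transfinite compositions of length `κ`. -/
lemma hasSmallObjectArgument_of_isLocallyPresentable {K : Type u} [Category.{v} K]
    [IsLocallyPresentable.{w} K] [HasPushouts K] (I : MorphismProperty K)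
    [MorphismProperty.IsSmall.{w} I] : MorphismProperty.HasSmallObjectArgument.{w} I := by
  obtain ⟨κ₀, _, _⟩ := IsLocallyPresentable.exists_cardinal.{w} K
  obtain ⟨κ, _, hκ, h⟩ := exists_regular_forall_isCardinalPresentable
    (fun i : I.toSet ↦ i.1.left) κ₀
  have : Nonempty κ.ord.ToType := by simpa using Cardinal.IsRegular.ne_zero Fact.out
  have := WellFoundedLT.toOrderBot κ.ord.ToType
  have : LocallySmall.{w} K :=
    HasCardinalFilteredGenerator.toLocallySmall (κ := κ₀)
  have : HasColimitsOfSize.{w, w} K :=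
    IsCardinalLocallyPresentable.toHasColimitsOfSize κ₀
  exact ⟨κ, inferInstance, inferInstance,
    { hasIterationOfShape := { }
      preservesColimit {A B X Y} i hi f hf := by
        have : IsCardinalPresentable A κ := h ⟨Arrow.mk i, hi⟩
        have := preservesColimitsOfShape_of_isCardinalPresentable A κ κ.ord.ToType
        infer_instance }⟩


/-- A `κ`-presentable quotient of a `κ`-filtered colimit is a quotient of some stage. -/
lemma exists_epi_of_isColimit {κ : Cardinal.{w}} [Fact κ.IsRegular] {J : Type w}
    [SmallCategory J] [IsCardinalFiltered J κ] {F : J ⥤ K} {c : Cocone F} (hc : IsColimit c)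
    [HasColimitsOfShape J K]
    {S : K} [IsCardinalPresentable S κ] (p : c.pt ⟶ S) [Epi p] :
    ∃ j, Epi (c.ι.app j ≫ p) := by
  have := isFiltered_of_isCardinalFiltered J κ
  have := IsFiltered.nonempty (C := J)
  -- Exactness of filtered colimits is avoided: the map from `S` to the colimit of the cokernels of
  -- `α` vanishes since `p` is epi, hence by presentability it already vanishes at some stage `j`,
  -- where `α` is then epi.
  let α : F ⟶ (Functor.const J).obj S := c.ι ≫ (Functor.const J).map p
  let π : (Functor.const J).obj S ⟶ cokernel α := cokernel.π α
  let d := colimit.cocone (cokernel α)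
  let j₀ : J := Classical.arbitrary J
  have hπ (j j' : J) (f : j ⟶ j') : π.app j ≫ (cokernel α).map f = π.app j' := by
    rw [← π.naturality f]; simp
  have h0 (j : J) : π.app j ≫ d.ι.app j = π.app j₀ ≫ d.ι.app j₀ := by
    obtain ⟨k, a, b, _⟩ := IsFilteredOrEmpty.cocone_objs j j₀
    rw [← d.w a, ← d.w b, reassoc_of% hπ, reassoc_of% hπ]
  have hz : π.app j₀ ≫ d.ι.app j₀ = 0 := by
    rw [← cancel_epi p, comp_zero]
    refine hc.hom_ext fun j ↦ ?_
    have : α.app j ≫ π.app j = 0 := by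
      rw [← NatTrans.comp_app, cokernel.condition]; rfl
    rw [comp_zero, ← h0 j]
    simpa [α] using congr($this ≫ d.ι.app j)
  obtain ⟨j, f, hf⟩ := IsCardinalPresentable.exists_eq_of_isColimit' (X := S) κ (colimit.isColimit _)
    (π.app j₀) 0 (by rw [zero_comp]; exact hz)
  rw [hπ, zero_comp] at hf
  have hα : (ShortComplex.mk α π (cokernel.condition α)).Exact :=
    ShortComplex.exact_of_g_is_cokernel _ (cokernelIsCokernel α)
  exact ⟨j, (hα.map ((evaluation J K).obj j)).epi_f hf⟩

/-! ### A small set of monomorphisms detecting `𝒞`-Epi -/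

lemma relMono_kernel_ι (h : IsCotorsionTheory ℱ 𝒞) {B S : K} (q : B ⟶ S) [Epi q] (hS : ℱ S) :
    relMono ℱ (kernel.ι q) :=
  ⟨inferInstance, h.left_of_iso
    ((Abelian.epiIsCokernelOfKernel _ (kernelIsKernel q)).coconePointUniqueUpToIso
      (colimit.isColimit _)) hS⟩

open ZeroObject in
lemma relMono_zero_iff (h : IsCotorsionTheory ℱ 𝒞) {F : K} :
    relMono ℱ (0 : 0 ⟶ F) ↔ ℱ F :=
  ⟨fun hF ↦ h.left_of_iso cokernelZeroIsoTarget hF.2,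
    fun hF ↦ ⟨inferInstance, h.left_of_iso cokernelZeroIsoTarget.symm hF⟩⟩

/-- If every epimorphism onto an object `S` of `𝒮` is refined by an epimorphism from an object
of `P`, then the kernels of the epimorphisms from objects of `P` to objects of `𝒮` detect
membership of kernels in `𝒮^⊥`. -/
lemma rightPerp_kernel_of_rlp {P 𝒮 : ObjectProperty K}
    (hP : ∀ {E S : K} (p : E ⟶ S), 𝒮 S → Epi p → ∃ (B : K) (b : B ⟶ E), P B ∧ Epi (b ≫ p))
    {X Y : K} (g : X ⟶ Y)
    (hg : ∀ {B S : K} (q : B ⟶ S), P B → 𝒮 S → Epi q → HasLiftingProperty (kernel.ι q) g) :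
    rightPerp 𝒮 (kernel g) := by
  refine fun S hS ↦ extOneVanishes_of_section fun {E} i p w hE ↦ ?_
  have := hE.mono_f
  have := hE.epi_g
  obtain ⟨B, b, hB, _⟩ := hP p hS hE.epi_g
  have := hg (b ≫ p) hB hS inferInstance
  let n : kernel (b ≫ p) ⟶ kernel g :=
    hE.exact.lift (kernel.ι (b ≫ p) ≫ b) (by simp)
  have hn : n ≫ i = kernel.ι (b ≫ p) ≫ b := hE.exact.lift_f _ _
  -- The zero bottom map forces the lift into `ker g`, so it extends `n` to `m` on `B`. Then `b - m
  -- ≫ i` kills the kernel of `b ≫ p` and descends to a section.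
  have sq : CommSq (n ≫ kernel.ι g) (kernel.ι (b ≫ p)) g 0 := ⟨by simp⟩
  let m : B ⟶ kernel g := kernel.lift g sq.lift sq.fac_right
  have hm : kernel.ι (b ≫ p) ≫ m = n := by
    rw [← cancel_mono (kernel.ι g), Category.assoc, kernel.lift_ι, sq.fac_left]
  let s : S ⟶ E := Abelian.epiDesc (b ≫ p) (b - m ≫ i) (by
    rw [Preadditive.comp_sub, reassoc_of% hm, hn, sub_self])
  refine ⟨s, ?_⟩
  rw [← cancel_epi (b ≫ p), ← Category.assoc, Abelian.comp_epiDesc]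
  simp [w]

open ZeroObject in
/-- A cotorsion theory generated by a set has a small set of `ℱ`-monomorphisms which determines
the class of `𝒞`-epimorphisms. -/
lemma IsCotorsionTheory.exists_isSmall_rlp_eq [IsLocallyPresentable.{w} K]
    (h : IsCotorsionTheory ℱ 𝒞) (hgen : IsGeneratedBySet.{w} 𝒞)
    (hquot : ∀ X : K, ∃ (F : K) (p : F ⟶ X), ℱ F ∧ Epi p) :
    ∃ I : MorphismProperty K, MorphismProperty.IsSmall.{w} I ∧ I ≤ relMono ℱ ∧
      I.rlp = relEpi 𝒞 := by
  obtain ⟨𝒮, _, h𝒮⟩ := hgen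
  obtain ⟨κ₀, _, _⟩ := IsLocallyPresentable.exists_cardinal.{w} K
  obtain ⟨κ, _, hκ, hS⟩ := exists_regular_forall_isCardinalPresentable
    (fun S : Subtype 𝒮 ↦ S.1) κ₀
  have := IsCardinalLocallyPresentable.of_le K hκ
  have : LocallySmall.{w} K := HasCardinalFilteredGenerator.toLocallySmall (κ := κ)
  have : HasColimitsOfSize.{w, w} K := IsCardinalLocallyPresentable.toHasColimitsOfSize κ
  obtain ⟨P, _, hP⟩ := HasCardinalFilteredGenerator.exists_small_generator K κ
  have h𝒮ℱ (S : K) (hS : 𝒮 S) : ℱ S := by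
    rw [h.left_eq, h𝒮]
    exact fun B hB ↦ hB S hS
  choose F π hF hπ using hquot
  let ι := Σ (S : Subtype 𝒮) (B : Subtype P), {q : B.1 ⟶ S.1 // Epi q}
  let I₁ : MorphismProperty K := .ofHoms fun i : ι ↦ kernel.ι i.2.2.1
  let I₂ : MorphismProperty K := .ofHoms fun G : Subtype P ↦ (0 : 0 ⟶ F G.1)
  have hI : I₁ ⊔ I₂ ≤ relMono ℱ := by
    refine sup_le ?_ ?_
    · rintro _ _ _ ⟨⟨⟨S, hS⟩, B, ⟨q, hq⟩⟩⟩
      exact relMono_kernel_ι h q (h𝒮ℱ S hS)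
    · rintro _ _ _ ⟨G⟩
      exact (relMono_zero_iff h).2 (hF _)
  refine ⟨I₁ ⊔ I₂, ?_, hI, le_antisymm (fun X Y g hg ↦ ⟨?_, ?_⟩)
    (h.relEpi_le_rlp.trans (MorphismProperty.antitone_rlp hI))⟩
  · exact ⟨show Small.{w} (I₁.toSet ∪ I₂.toSet : Set _) from inferInstance⟩
  · refine Preadditive.epi_of_cancel_zero _ fun {Z} k hk ↦ ?_
    -- It suffices to test `k` on maps `f` from objects of `P`; precomposed with the cover `π G`,
    -- such a map lifts through `g`, and `g ≫ k = 0`.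
    refine (Preadditive.isSeparating_iff P).1 hP.isStrongGenerator.isSeparating k fun G hG f ↦ ?_
    have := hg _ (Or.inr ⟨(⟨G, hG⟩ : Subtype P)⟩)
    have sq : CommSq 0 (0 : 0 ⟶ F G) g (π G ≫ f) := ⟨by simp⟩
    have := hπ G
    rw [← cancel_epi (π G), comp_zero, ← Category.assoc, ← sq.fac_right, Category.assoc, hk,
      comp_zero]
  · rw [h𝒮]
    refine rightPerp_kernel_of_rlp (P := P) (fun {E S} p hS' hp ↦ ?_) g fun {B S} q hB hS hq ↦ ?_
    · obtain ⟨J, _, _, ⟨c⟩⟩ := hP.exists_colimitsOfShape E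
      have : IsCardinalPresentable S κ := hS ⟨S, hS'⟩
      obtain ⟨j, hj⟩ := exists_epi_of_isColimit (κ := κ) c.isColimit p
      exact ⟨_, _, c.prop_diag_obj j, hj⟩
    · exact hg _ (Or.inl (MorphismProperty.ofHoms_iff _ _ |>.2
        ⟨⟨⟨S, hS⟩, ⟨B, hB⟩, ⟨q, hq⟩⟩, rfl⟩))

end
end Cotorsion

open ZeroObject in
theorem mainTheorem3 {K : Type u} [Category.{v} K] [Abelian K] [IsLocallyPresentable.{w} K]
    (ℱ 𝒞 : ObjectProperty K)
    (hcot : Cotorsion.IsCotorsionTheory ℱ 𝒞)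
    (hgen : Cotorsion.IsGeneratedBySet.{w} 𝒞)
    (hquot : ∀ X : K, ∃ (F : K) (p : F ⟶ X), ℱ F ∧ Epi p)
    (hsub : ∀ X : K, ∃ (C : K) (i : X ⟶ C), 𝒞 C ∧ Mono i) :
    (Cotorsion.relMono ℱ).IsWeakFactorizationSystem (Cotorsion.relEpi 𝒞) ∧
      Cotorsion.IsCompleteCotorsionTheory ℱ 𝒞 := by
  obtain ⟨I, _, hI, hrlp⟩ := hcot.exists_isSmall_rlp_eq hgen hquot
  have := Cotorsion.hasSmallObjectArgument_of_isLocallyPresentable I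
  have hllp : (Cotorsion.relEpi 𝒞).llp = Cotorsion.relMono ℱ :=
    le_antisymm (hcot.llp_le_relMono hsub) hcot.relMono_le_llp
  have hfac : (Cotorsion.relMono ℱ).HasFactorization (Cotorsion.relEpi 𝒞) := by
    have : I.rlp.llp.HasFactorization I.rlp := inferInstance
    rwa [hrlp, hllp] at this
  refine ⟨⟨le_antisymm ?_ hcot.relEpi_le_rlp, hllp, hfac⟩, hcot, fun X ↦ ?_, fun X ↦ ?_⟩
  · exact hrlp ▸ MorphismProperty.antitone_rlp hI
  · let φ := MorphismProperty.factorizationData (Cotorsion.relMono ℱ) (Cotorsion.relEpi 𝒞)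
      (0 : 0 ⟶ X)
    refine ⟨φ.Z, φ.p, (Cotorsion.relMono_zero_iff hcot).1 ?_, φ.hp⟩
    rw [(isZero_zero K).eq_of_src 0 φ.i]
    exact φ.hi
  · let φ := MorphismProperty.factorizationData (Cotorsion.relMono ℱ) (Cotorsion.relEpi 𝒞)
      (0 : X ⟶ 0)
    refine ⟨φ.Z, φ.i, (Cotorsion.relEpi_zero_iff hcot).1 ?_, φ.hi⟩
    rw [(isZero_zero K).eq_of_tgt 0 φ.p]
    exact φ.hp
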